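/- Let $S_k$ denote the symmetric group on $\{1,\dots,k\}$, let $e_k$ be its identity, and write $a^{\uparrow m}=a(a+1)\cdots(a+m-1)$, $a^{\uparrow 0}=1$. For positive integers $k\le n$ and $\pi\in S_k$, the unitary Weingarten function is $$\mathrm{Wg}_{k,n}(\pi)=\mathbb{E}\bigl[u_{11}u_{22}\cdots u_{kk}\,\overline{u_{1\pi(1)}u_{2\pi(2)}\cdots u_{k\pi(k)}}\bigr],$$ where $U=(u_{ij})$ is a Haar-distributed random matrix in the unitary group $\mathrm{U}(n)$. For positive integers $k,n$ and $\sigma\in S_k$ with $\mathrm{fix}(\sigma)$ fixed points, the ascension function is $$A_{k,n}(\sigma)=\sum_{t=0}^{\mathrm{fix}(\sigma)}(-1)^{k-t}\binom{\mathrm{fix}(\sigma)}{t}\frac{1}{n^{\uparrow(k-t)}}.$$ For $n\ge 2$, $\pi\in S_n$ and $\tau\in S_{n-1}$, put $\mathrm{fix}(\pi,\tau)=|\{i\in\{1,\dots,n-1\} : \pi(\tau(i))=i\}|$ and $$a_n(\pi,\tau)=\sum_{t=0}^{\mathrm{fix}(\pi,\tau)}(-1)^{n-t+1}\binom{\mathrm{fix}(\pi,\tau)}{t}\frac{1}{n^{\uparrow(n-t)}}.$$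 **Proposition.** Let $k$ and $n$ be positive integers with $k\le n$. Then for every $\pi\in S_k$, $$\mathrm{Wg}_{k,n}(\pi)=\sum \Bigl(\prod_{j=k}^{n-1}A_{k,j+1}\bigl(\sigma_{j+1}\sigma_{j}^{-1}\bigr)\Bigr)\Bigl(\prod_{j=1}^{k-1}a_{j+1}(\tau_{j+1},\tau_{j})\Bigr),$$ that is, each term is $A_{k,n}(\pi\sigma_{n-1}^{-1})A_{k,n-1}(\sigma_{n-1}\sigma_{n-2}^{-1})\cdots A_{k,k+1}(\sigma_{k+1}\sigma_k^{-1})\,a_k(\sigma_k,\tau_{k-1})a_{k-1}(\tau_{k-1},\tau_{k-2})\cdots a_2(\tau_2,e_1)$, where the sum runs over all sequences $$(\sigma_{n-1},\dots,\sigma_k,\tau_{k-1},\dots,\tau_2)\in \underbrace{S_k\times\cdots\times S_k}_{n-k}\times S_{k-1}\times\cdots\times S_2,$$ and where $\sigma_n:=\pi$, $\tau_k:=\sigma_k$ and $\tau_1:=e_1$; empty products are $1$, and an empty list of summation variables contributes exactly one term. -/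

import Mathlib

namespace Weingarten

open MeasureTheory

/-! ### Haar probability measure on the unitary group `U(n)` -/

noncomputable instance instMeasurableSpaceUnitary (n : ℕ) : MeasurableSpace (Matrix.unitaryGroup (Fin n) ℂ) :=
  borel _

instance instBorelSpaceUnitary (n : ℕ) : BorelSpace (Matrix.unitaryGroup (Fin n) ℂ) :=
  ⟨rfl⟩

instance instCompactSpaceUnitary (n : ℕ) : CompactSpace (Matrix.unitaryGroup (Fin n) ℂ) := by
  refine (isCompact_iff_compactSpace
    (s := (Matrix.unitaryGroup (Fin n) ℂ : Set (Matrix (Fin n) (Fin n) ℂ)))).mp ?_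
  have hbig : IsCompact (Set.univ.pi fun _ : Fin n => Set.univ.pi fun _ : Fin n =>
      Metric.closedBall (0 : ℂ) 1) :=
    isCompact_univ_pi fun _ => isCompact_univ_pi fun _ => isCompact_closedBall _ _
  have hclosed : IsClosed {A : Matrix (Fin n) (Fin n) ℂ | A * star A = 1} :=
    isClosed_eq (continuous_id.mul continuous_star) continuous_const
  refine hbig.of_isClosed_subset ?_ ?_
  · have hset : (Matrix.unitaryGroup (Fin n) ℂ : Set (Matrix (Fin n) (Fin n) ℂ)) =
        {A | A * star A = 1} := Set.ext fun A => Matrix.mem_unitaryGroup_iff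
    rw [hset]
    exact hclosed
  · intro U hU i _ j _
    simpa using entry_norm_bound_of_unitary hU i j

/-- The Haar measure on `U(n)`, normalized so that `U(n)` has total mass `1`. -/
noncomputable def haarUnitary (n : ℕ) : Measure (Matrix.unitaryGroup (Fin n) ℂ) :=
  Measure.haarMeasure ⊤

/-- The Haar measure on `U(n)` is a probability measure. -/
instance instIsProbabilityMeasureHaarUnitary (n : ℕ) : IsProbabilityMeasure (haarUnitary n) := by
  constructor
  have h := Measure.haarMeasure_self
    (K₀ := (⊤ : TopologicalSpace.PositiveCompacts (Matrix.unitaryGroup (Fin n) ℂ)))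
  simpa [haarUnitary] using h

/-- The Weingarten function of `U(n)` on `S_k`, for `k ≤ n`:
`Wg_{k,n}(π) = 𝔼[u₁₁ u₂₂ ⋯ u_{kk} · conj (u_{1π(1)} u_{2π(2)} ⋯ u_{kπ(k)})]`. -/
noncomputable def Wg {k n : ℕ} (h : k ≤ n) (π : Equiv.Perm (Fin k)) : ℂ :=
  ∫ U : Matrix.unitaryGroup (Fin n) ℂ,
    (∏ i : Fin k, (U : Matrix (Fin n) (Fin n) ℂ) (Fin.castLE h i) (Fin.castLE h i)) *
      star (∏ i : Fin k, (U : Matrix (Fin n) (Fin n) ℂ) (Fin.castLE h i) (Fin.castLE h (π i)))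
    ∂(haarUnitary n)

/-! ### The ascension functions `A_{k,n}` and the coefficients `a_n` -/

/-- The number of fixed points of `σ ∈ S_k`. -/
def fix {k : ℕ} (σ : Equiv.Perm (Fin k)) : ℕ :=
  (Finset.univ.filter fun i : Fin k => σ i = i).card

/-- The ascension function
`A_{k,n}(σ) = ∑_{t=0}^{fix σ} (-1)^{k-t} (fix σ choose t) / (n (n+1) ⋯ (n+k-t-1))`. -/
noncomputable def ascension (k n : ℕ) (σ : Equiv.Perm (Fin k)) : ℂ :=
  ∑ t ∈ Finset.range (fix σ + 1),
    (-1 : ℂ) ^ (k - t) * ((fix σ).choose t : ℂ) * (1 / (n.ascFactorial (k - t) : ℂ))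

/-- The number of `i ∈ {1, …, m}` with `π(τ(i)) = i`, for `π ∈ S_{m+1}` and `τ ∈ S_m`. -/
def fixPair {m : ℕ} (π : Equiv.Perm (Fin (m + 1))) (τ : Equiv.Perm (Fin m)) : ℕ :=
  (Finset.univ.filter fun i : Fin m => π (τ i).castSucc = i.castSucc).card

/-- The coefficient `a_n : S_n × S_{n-1} → ℂ`, with `n = m + 1`:
`a_n(π, τ) = ∑_{t=0}^{fix(π,τ)} (-1)^{n-t+1} (fix(π,τ) choose t) / (n (n+1) ⋯ (n+(n-t)-1))`. -/
noncomputable def aCoeff (m : ℕ) (π : Equiv.Perm (Fin (m + 1))) (τ : Equiv.Perm (Fin m)) : ℂ :=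
  ∑ t ∈ Finset.range (fixPair π τ + 1),
    (-1 : ℂ) ^ ((m + 1) - t + 1) * ((fixPair π τ).choose t : ℂ) *
      (1 / ((m + 1).ascFactorial ((m + 1) - t) : ℂ))

/-! ### The sequences of permutations that index the sum -/

/-- The sequence `σ_k, …, σ_{n-1}` in `S_k`, continued by `σ_n := π`. -/
def sigmaSeq {k n : ℕ} (π : Equiv.Perm (Fin k)) (σ : Finset.Ico k n → Equiv.Perm (Fin k))
    (j : ℕ) : Equiv.Perm (Fin k) :=
  if h : j ∈ Finset.Ico k n then σ ⟨j, h⟩ else π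

/-- The sequence `τ_2, …, τ_{k-1}` with `τ_j ∈ S_j`, continued by `τ_k := ρ` at the upper end and
by the identity `τ_1 := e_1` at the lower end (if `k = 1`, the only value of interest is
`τ_1 = ρ = e_1`). -/
def tauSeq {k : ℕ} (ρ : Equiv.Perm (Fin k)) (τ : (j : Finset.Ico 2 k) → Equiv.Perm (Fin j))
    (j : ℕ) : Equiv.Perm (Fin j) :=
  if h : j ∈ Finset.Ico 2 k then τ ⟨j, h⟩
  else if h : k = j then (finCongr h).permCongr ρ
  else 1

end Weingarten

namespace Weingarten

open MeasureTheory Equiv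

/-! ### Left invariance of the Haar measure on `U(n)` -/

section Haar

variable {n : ℕ}

/-! Write J for right convolution with the sum of the transpositions moving the last point of
`S_{m+1}`, and E for extension by zero from `S_m` to `S_{m+1}`. Left invariance evaluates moments
with a repeated row. Summing over the row of the last factor and using orthonormal columns gives (n
+ J) Wg_{m+1,n} = E(Wg_{m,n}) (`jucysMurphy_wg`). For m < n the operator n + J is injective
(`jucysMurphy_injective`), so identities for Wg may be checked after applying it.

Let g(π) be the ascension sum with the number of fixed points other than the last. Pascal's rule
gives A_{m+1,n} = g + E(A_{m,n}), and counting how transpositions change fixed points gives (n + J)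
g = -E(A_{m,n}) (`jucysMurphy_fixInit`). Hence (n + 1 + J) A_{m+1,n+1} = (n + J) E(A_{m,n+1}), and
induction on k yields Wg_{k,n+1} = A_{k,n+1} * Wg_{k,n} (`wg_succ_right`). Since a_{m+1}(π, τ) =
-g(πτ) at n = m + 1, the same method expresses Wg_{m+1,m+1} through Wg_{m,m} (`wg_succ_succ`).
Iterating the first identity from n down to k and the second from k down to 1 gives the formula. -/

instance : (haarUnitary n).IsMulLeftInvariant := by
  unfold haarUnitary; infer_instance

lemma continuous_entry (i j : Fin n) :
    Continuous fun U : Matrix.unitaryGroup (Fin n) ℂ => (U : Matrix (Fin n) (Fin n) ℂ) i j :=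
  continuous_subtype_val.matrix_elem i j

lemma integrable_of_continuous {F : Matrix.unitaryGroup (Fin n) ℂ → ℂ} (hF : Continuous F) :
    Integrable F (haarUnitary n) :=
  hF.integrable_of_hasCompactSupport (HasCompactSupport.of_compactSpace _)

/-- The matrix acting by `!![a, b; c, d]` on the coordinates `x`, `y` and trivially elsewhere. -/
noncomputable def twoRow (x y : Fin n) (a b c d : ℂ) : Matrix (Fin n) (Fin n) ℂ :=
  Matrix.of fun i =>
    if i = x then a • Pi.single x 1 + b • Pi.single y 1
    else if i = y then c • Pi.single x 1 + d • Pi.single y 1 else Pi.single i 1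

lemma twoRow_mul_apply (x y : Fin n) (a b c d : ℂ) (M : Matrix (Fin n) (Fin n) ℂ) (i j : Fin n) :
    (twoRow x y a b c d * M) i j =
      if i = x then a * M x j + b * M y j
      else if i = y then c * M x j + d * M y j else M i j := by
  simp only [Matrix.mul_apply, twoRow, Matrix.of_apply]
  split_ifs <;>
    simp [Pi.single_apply, add_mul, Finset.sum_add_distrib]

lemma twoRow_mem {x y : Fin n} (hxy : x ≠ y) {a b c d : ℂ}
    (h1 : a * star a + b * star b = 1) (h2 : c * star c + d * star d = 1)
    (h3 : a * star c + b * star d = 0) :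
    twoRow x y a b c d ∈ Matrix.unitaryGroup (Fin n) ℂ := by
  have h4 : c * star a + d * star b = 0 := by
    have := congrArg star h3
    simp only [star_add, star_mul, star_star, star_zero] at this
    linear_combination this
  rw [Matrix.mem_unitaryGroup_iff]
  ext i j
  rw [twoRow_mul_apply]
  simp only [Matrix.star_apply, twoRow, Matrix.of_apply, Matrix.one_apply]
  by_cases hix : i = x
  · subst hix
    by_cases hj : j = i
    · subst hj; simpa [hxy, hxy.symm] using h1
    · by_cases hjy : j = y
      · subst hjy; simpa [hxy, hxy.symm] using h3
      · simp [hj, hjy, Ne.symm hj, Ne.symm hjy]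
  · by_cases hiy : i = y
    · subst hiy
      by_cases hj : j = x
      · subst hj; simpa [hxy, hxy.symm] using h4
      · by_cases hjy : j = i
        · subst hjy; simpa [hxy, hxy.symm] using h2
        · simp [hj, hjy, Ne.symm hj, Ne.symm hjy, hxy.symm]
    · by_cases hj : j = x
      · subst hj; simp [hix, hiy]
      · by_cases hjy : j = y
        · subst hjy; simp [hix, hiy, hxy.symm]
        · simp [hix, hiy, hj, hjy, Pi.single_apply]

lemma integral_twoRow {x y : Fin n} (hxy : x ≠ y) {a b c d : ℂ}
    (h1 : a * star a + b * star b = 1) (h2 : c * star c + d * star d = 1)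
    (h3 : a * star c + b * star d = 0) (F : Matrix (Fin n) (Fin n) ℂ → ℂ) :
    ∫ U : Matrix.unitaryGroup (Fin n) ℂ, F (twoRow x y a b c d * U) ∂haarUnitary n =
      ∫ U : Matrix.unitaryGroup (Fin n) ℂ, F U ∂haarUnitary n :=
  integral_mul_left_eq_self (μ := haarUnitary n)
    (fun U : Matrix.unitaryGroup (Fin n) ℂ => F U) ⟨_, twoRow_mem hxy h1 h2 h3⟩

/-- If the row `x` occurs twice in a moment, then the moment is a sum of two moments in which
one of the occurrences is replaced by a row `y` which does not occur otherwise. -/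
lemma integral_double_row {x y : Fin n} (hxy : x ≠ y) (c₁ c₂ d₁ d₂ : Fin n)
    (R : Matrix (Fin n) (Fin n) ℂ → ℂ)
    (hR : ∀ M N : Matrix (Fin n) (Fin n) ℂ, (∀ i, i ≠ x → i ≠ y → M i = N i) → R M = R N)
    (hRc : Continuous fun U : Matrix.unitaryGroup (Fin n) ℂ => R U) :
    ∫ U : Matrix.unitaryGroup (Fin n) ℂ,
        U.1 x c₁ * U.1 x c₂ * star (U.1 x d₁ * U.1 x d₂) * R U.1 ∂haarUnitary n =
      ∫ U : Matrix.unitaryGroup (Fin n) ℂ,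
        U.1 x c₁ * U.1 y c₂ * star (U.1 x d₁ * U.1 y d₂) * R U.1 ∂haarUnitary n +
      ∫ U : Matrix.unitaryGroup (Fin n) ℂ,
        U.1 x c₁ * U.1 y c₂ * star (U.1 y d₁ * U.1 x d₂) * R U.1 ∂haarUnitary n := by
  set F : Matrix (Fin n) (Fin n) ℂ → ℂ := fun M =>
    M x c₁ * M x c₂ * star (M x d₁ * M x d₂) * R M with hF
  set G : Matrix (Fin n) (Fin n) ℂ → ℂ := fun M =>
    M x c₁ * M y c₂ * star (M x d₁ * M y d₂) * R M with hG
  set G' : Matrix (Fin n) (Fin n) ℂ → ℂ := fun M =>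
    M x c₁ * M y c₂ * star (M y d₁ * M x d₂) * R M with hG'
  have hmul : ∀ u v p q, ∀ M : Matrix (Fin n) (Fin n) ℂ, R (twoRow x y u v p q * M) = R M :=
    fun u v p q M => hR _ _ fun i hx hy => funext fun j => by
      rw [twoRow_mul_apply, if_neg hx, if_neg hy]
  obtain ⟨s, hs, hss⟩ : ∃ s : ℂ, s * s = 1 / 2 ∧ star s = s := by
    refine ⟨((Real.sqrt (1 / 2) : ℝ) : ℂ), ?_, Complex.conj_ofReal _⟩
    rw [← Complex.ofReal_mul, Real.mul_self_sqrt (by norm_num)]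
    norm_num
  -- `H w` replaces row `x` by `s` times (row `x` plus `w` times row `y`). Averaging over the fourth
  -- roots of unity `w` keeps only terms with as many `y`'s among the plain factors as among the
  -- conjugated ones: `F`, `G`, `G'` and their images under the row exchange `S`.
  set H : ℂ → Matrix (Fin n) (Fin n) ℂ := fun w => twoRow x y s (s * w) (-(s * star w)) s with hH
  set S : Matrix (Fin n) (Fin n) ℂ := twoRow x y 0 1 1 0 with hS
  have hI : (Complex.I : ℂ) ^ 2 = -1 := Complex.I_sq
  have hsI : star (Complex.I) = -Complex.I := Complex.conj_I
  have hpt : ∀ M : Matrix (Fin n) (Fin n) ℂ,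
      F (H 1 * M) + F (H (-1) * M) + F (H Complex.I * M) + F (H (-Complex.I) * M) =
        F M + F (S * M) + G M + G (S * M) + G' M + G' (S * M) := by
    intro M
    have hs4 : s ^ 4 = 1 / 4 := by linear_combination (s * s + 1 / 2) * hs
    have hI4 : (Complex.I : ℂ) ^ 4 = 1 := Complex.I_pow_four
    simp only [hF, hG, hG', hH, hS, hmul, twoRow_mul_apply, if_true, if_neg hxy.symm, star_mul,
      star_add, star_neg, star_one, star_zero, hss, hsI]
    generalize R M = r
    generalize M x c₁ = a₁
    generalize M x c₂ = a₂
    generalize M y c₁ = b₁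
    generalize M y c₂ = b₂
    generalize star (M x d₁) = e₁
    generalize star (M x d₂) = e₂
    generalize star (M y d₁) = f₁
    generalize star (M y d₂) = f₂
    ring_nf
    simp only [hs4, hI, hI4]
    ring
  have hw : ∀ w : ℂ, w * star w = 1 → ∫ U : Matrix.unitaryGroup (Fin n) ℂ, F (H w * U.1)
      ∂haarUnitary n = ∫ U : Matrix.unitaryGroup (Fin n) ℂ, F U.1 ∂haarUnitary n := by
    intro w hw
    refine integral_twoRow hxy ?_ ?_ ?_ F <;>
      simp only [star_mul, star_neg, star_star, hss]
    · linear_combination (s * s) * hw + 2 * hs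
    · linear_combination (s * s) * hw + 2 * hs
    · ring
  have hsw : ∀ K : Matrix (Fin n) (Fin n) ℂ → ℂ, ∫ U : Matrix.unitaryGroup (Fin n) ℂ, K (S * U.1)
      ∂haarUnitary n = ∫ U : Matrix.unitaryGroup (Fin n) ℂ, K U.1 ∂haarUnitary n :=
    integral_twoRow hxy (by simp) (by simp) (by simp)
  have hmc : ∀ A : Matrix (Fin n) (Fin n) ℂ,
      Continuous fun U : Matrix.unitaryGroup (Fin n) ℂ => A * U.1 :=
    fun A => continuous_const.matrix_mul continuous_subtype_val
  have hint : ∀ (a b c d : Fin n) (A : Matrix (Fin n) (Fin n) ℂ),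
      (∀ M, R (A * M) = R M) → Integrable (fun U : Matrix.unitaryGroup (Fin n) ℂ =>
        (A * U.1) a c₁ * (A * U.1) b c₂ * star ((A * U.1) c d₁ * (A * U.1) d d₂) * R (A * U.1))
        (haarUnitary n) := by
    intro a b c d A hA
    apply integrable_of_continuous
    simp only [hA]
    have := fun i j => (hmc A).matrix_elem i j
    exact ((((this _ _).mul (this _ _)).mul (((this _ _).mul (this _ _)).star))).mul hRc
  have hint1 : ∀ a b c d : Fin n, Integrable (fun U : Matrix.unitaryGroup (Fin n) ℂ =>
        U.1 a c₁ * U.1 b c₂ * star (U.1 c d₁ * U.1 d d₂) * R U.1) (haarUnitary n) := by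
    intro a b c d
    simpa using hint a b c d 1 (by simp)
  have iH : ∀ w, Integrable (fun U : Matrix.unitaryGroup (Fin n) ℂ => F (H w * U.1))
      (haarUnitary n) := fun w => hint x x x x _ (hmul _ _ _ _)
  have iF : Integrable (fun U : Matrix.unitaryGroup (Fin n) ℂ => F U.1) _ := hint1 x x x x
  have iFS : Integrable (fun U : Matrix.unitaryGroup (Fin n) ℂ => F (S * U.1)) _ :=
    hint x x x x S (hmul _ _ _ _)
  have iG : Integrable (fun U : Matrix.unitaryGroup (Fin n) ℂ => G U.1) _ := hint1 x y x y
  have iGS : Integrable (fun U : Matrix.unitaryGroup (Fin n) ℂ => G (S * U.1)) _ :=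
    hint x y x y S (hmul _ _ _ _)
  have iG' : Integrable (fun U : Matrix.unitaryGroup (Fin n) ℂ => G' U.1) _ := hint1 x y y x
  have iGS' : Integrable (fun U : Matrix.unitaryGroup (Fin n) ℂ => G' (S * U.1)) _ :=
    hint x y y x S (hmul _ _ _ _)
  have hsum := integral_congr_ae (μ := haarUnitary n)
    (Filter.Eventually.of_forall fun U : Matrix.unitaryGroup (Fin n) ℂ => hpt U.1)
  have e₁ := integral_add' (((iH 1).add (iH (-1))).add (iH Complex.I)) (iH (-Complex.I))
  have e₂ := integral_add' ((((iF.add iFS).add iG).add iGS).add iG') iGS'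
  rw [integral_add' ((iH _).add (iH _)) (iH _), integral_add' (iH _) (iH _),
    hw 1 (by simp), hw (-1) (by simp), hw Complex.I (by simp [hsI]),
    hw (-Complex.I) (by simp [hsI])] at e₁
  rw [integral_add' (((iF.add iFS).add iG).add iGS) iG',
    integral_add' ((iF.add iFS).add iG) iGS, integral_add' (iF.add iFS) iG,
    integral_add' iF iFS, hsw F, hsw G, hsw G'] at e₂
  -- By invariance this reads 4∫F = 2∫F + 2∫G + 2∫G'.
  have h := (e₁.symm.trans hsum).trans e₂
  linear_combination h / 2

end Haar

/-! ### Invariance under permutations of the rows -/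

section Haar

variable {n : ℕ}

lemma integral_submatrix (g : Perm (Fin n)) (F : Matrix (Fin n) (Fin n) ℂ → ℂ) :
    ∫ U : Matrix.unitaryGroup (Fin n) ℂ, F (U.1.submatrix g id) ∂haarUnitary n =
      ∫ U : Matrix.unitaryGroup (Fin n) ℂ, F U.1 ∂haarUnitary n := by
  have hg : g.permMatrix ℂ ∈ Matrix.unitaryGroup (Fin n) ℂ := by
    rw [Matrix.mem_unitaryGroup_iff, Matrix.star_eq_conjTranspose,
      Matrix.conjTranspose_permMatrix, PEquiv.toMatrix_toPEquiv_mul]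
    ext i j
    simp [PEquiv.toMatrix_apply, Matrix.one_apply]
  have h := integral_mul_left_eq_self (μ := haarUnitary n)
    (fun U : Matrix.unitaryGroup (Fin n) ℂ => F U) ⟨_, hg⟩
  simpa only [Submonoid.coe_mul, PEquiv.toMatrix_toPEquiv_mul] using h

end Haar

/-! ### The recursion for the Weingarten function -/

/-- The extension of a permutation of `{1, …, m}` to `{1, …, m + 1}` fixing the last point. -/
def extendLast {m : ℕ} (τ : Perm (Fin m)) : Perm (Fin (m + 1)) where
  toFun := Fin.lastCases (motive := fun _ => Fin (m + 1)) (Fin.last m) fun i => (τ i).castSucc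
  invFun :=
    Fin.lastCases (motive := fun _ => Fin (m + 1)) (Fin.last m) fun i => (τ.symm i).castSucc
  left_inv i := by induction i using Fin.lastCases <;> simp
  right_inv i := by induction i using Fin.lastCases <;> simp

section extendLast

variable {m : ℕ}

@[simp] lemma extendLast_castSucc (τ : Perm (Fin m)) (i : Fin m) :
    extendLast τ i.castSucc = (τ i).castSucc := by simp [extendLast]

@[simp] lemma extendLast_last (τ : Perm (Fin m)) : extendLast τ (Fin.last m) = Fin.last m := by
  simp [extendLast]

lemma extendLast_mul (σ τ : Perm (Fin m)) :
    extendLast (σ * τ) = extendLast σ * extendLast τ := by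
  ext i; induction i using Fin.lastCases <;> simp

lemma extendLast_inv (τ : Perm (Fin m)) : extendLast τ⁻¹ = (extendLast τ)⁻¹ := by
  rw [eq_inv_iff_mul_eq_one, ← extendLast_mul]
  ext i; induction i using Fin.lastCases <;> simp

lemma extendLast_injective : Function.Injective (extendLast (m := m)) := by
  intro σ τ h
  ext i
  have := congrArg (fun π => π i.castSucc) h
  simpa [Fin.ext_iff] using this

lemma exists_extendLast_eq {π : Perm (Fin (m + 1))} (h : π (Fin.last m) = Fin.last m) :
    ∃ τ : Perm (Fin m), extendLast τ = π := by
  have h1 : ∀ ρ : Perm (Fin (m + 1)), ρ (Fin.last m) = Fin.last m → ∀ i : Fin m,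
      ρ i.castSucc ≠ Fin.last m := by
    intro ρ hρ i hi
    exact (Fin.castSucc_lt_last i).ne (ρ.injective (hi.trans hρ.symm))
  have h2 : π⁻¹ (Fin.last m) = Fin.last m := by rw [Perm.inv_eq_iff_eq, h]
  refine ⟨⟨fun i => (π i.castSucc).castPred (h1 π h i),
    fun i => (π⁻¹ i.castSucc).castPred (h1 π⁻¹ h2 i), fun i => ?_, fun i => ?_⟩, ?_⟩
  · simp
  · simp
  · ext i
    induction i using Fin.lastCases <;> simp [h]

end extendLast

/-! ### Orthogonality relations from the orthonormality of the columns -/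

section Recursion

variable {m n : ℕ}

/-- The moment defining `Wg`, with the last row replaced by the row `x`. -/
noncomputable def rowMoment (h : m + 1 ≤ n) (π : Perm (Fin (m + 1))) (x : Fin n) : ℂ :=
  ∫ U : Matrix.unitaryGroup (Fin n) ℂ,
    (∏ i : Fin m, U.1 (Fin.castLE h i.castSucc) (Fin.castLE h i.castSucc)) *
      U.1 x (Fin.castLE h (Fin.last m)) *
      star ((∏ i : Fin m, U.1 (Fin.castLE h i.castSucc) (Fin.castLE h (π i.castSucc))) *
        U.1 x (Fin.castLE h (π (Fin.last m)))) ∂haarUnitary n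

lemma rowMoment_last (h : m + 1 ≤ n) (π : Perm (Fin (m + 1))) :
    rowMoment h π (Fin.castLE h (Fin.last m)) = Wg h π := by
  simp only [rowMoment, Wg, Fin.prod_univ_castSucc]

/-- Neither `x` nor the last row occurs in the first `m` factors, so exchanging these two rows
affects only the last factor. -/
lemma rowMoment_of_le (h : m + 1 ≤ n) (π : Perm (Fin (m + 1))) (x : Fin n) (hx : m ≤ x) :
    rowMoment h π x = Wg h π := by
  rw [← rowMoment_last, rowMoment, rowMoment]
  have := integral_submatrix (swap x (Fin.castLE h (Fin.last m))) fun M =>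
    (∏ i : Fin m, M (Fin.castLE h i.castSucc) (Fin.castLE h i.castSucc)) *
      M x (Fin.castLE h (Fin.last m)) *
      star ((∏ i : Fin m, M (Fin.castLE h i.castSucc) (Fin.castLE h (π i.castSucc))) *
        M x (Fin.castLE h (π (Fin.last m))))
  rw [← this]
  have hs : ∀ i : Fin m, swap x (Fin.castLE h (Fin.last m)) (Fin.castLE h i.castSucc) =
      Fin.castLE h i.castSucc := by
    intro i
    apply swap_apply_of_ne_of_ne
    · intro hi; have := congrArg Fin.val hi; simp at this; omega
    · intro hi; have := congrArg Fin.val hi; simp at this; omega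
  simp only [Matrix.submatrix_apply, id, hs, swap_apply_left]

/-- Row `j` occurs twice while the last row is free, so `integral_double_row` applies; the two
placements of the conjugated factors give the two permutations. -/
lemma rowMoment_castSucc (h : m + 1 ≤ n) (π : Perm (Fin (m + 1))) (j : Fin m) :
    rowMoment h π (Fin.castLE h j.castSucc) =
      Wg h π + Wg h (π * swap j.castSucc (Fin.last m)) := by
  have hinj : ∀ a b : Fin (m + 1), Fin.castLE h a = Fin.castLE h b ↔ a = b := fun a b =>
    (Fin.castLE_injective h).eq_iff
  have hne : Fin.castLE h j.castSucc ≠ Fin.castLE h (Fin.last m) := by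
    rw [Ne, hinj]; exact (Fin.castSucc_lt_last j).ne
  have key := integral_double_row hne (Fin.castLE h j.castSucc) (Fin.castLE h (Fin.last m))
    (Fin.castLE h (π j.castSucc)) (Fin.castLE h (π (Fin.last m)))
    (fun M => (∏ i ∈ Finset.univ.erase j,
        M (Fin.castLE h i.castSucc) (Fin.castLE h i.castSucc)) *
      star (∏ i ∈ Finset.univ.erase j,
        M (Fin.castLE h i.castSucc) (Fin.castLE h (π i.castSucc)))) (by
      intro M N hMN
      have : ∀ i ∈ Finset.univ.erase j, M (Fin.castLE h (Fin.castSucc i)) =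
          N (Fin.castLE h (Fin.castSucc i)) := by
        intro i hi
        apply hMN
        · rw [Ne, hinj]; simpa using hi
        · rw [Ne, hinj]; exact (Fin.castSucc_lt_last i).ne
      have h₁ := Finset.prod_congr rfl fun i hi =>
        congrFun (this i hi) (Fin.castLE h i.castSucc)
      have h₂ := Finset.prod_congr rfl fun i hi =>
        congrFun (this i hi) (Fin.castLE h (π i.castSucc))
      exact congrArg₂ (fun a b => a * star b) h₁ h₂) (by
      refine Continuous.mul ?_ (Continuous.star ?_) <;>
        exact continuous_finsetProd _ fun i _ => continuous_entry _ _)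
  have hsw : ∀ i ∈ Finset.univ.erase j,
      swap j.castSucc (Fin.last m) (Fin.castSucc i) = i.castSucc := by
    intro i hi
    apply swap_apply_of_ne_of_ne
    · simpa using hi
    · exact (Fin.castSucc_lt_last i).ne
  simp only [rowMoment, Wg, Fin.prod_univ_castSucc, Perm.mul_apply, swap_apply_right,
    ← Finset.mul_prod_erase _ _ (Finset.mem_univ j), swap_apply_left, star_mul]
  simp only [star_mul] at key
  convert key using 1
  · refine integral_congr_ae (Filter.Eventually.of_forall fun U => ?_)
    simp only
    ring
  · congr 1
    · refine integral_congr_ae (Filter.Eventually.of_forall fun U => ?_)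
      simp only
      ring
    · refine integral_congr_ae (Filter.Eventually.of_forall fun U => ?_)
      simp only
      have : ∏ i ∈ Finset.univ.erase j, U.1 (Fin.castLE h i.castSucc)
            (Fin.castLE h (π (swap j.castSucc (Fin.last m) i.castSucc))) =
          ∏ i ∈ Finset.univ.erase j, U.1 (Fin.castLE h i.castSucc)
            (Fin.castLE h (π i.castSucc)) :=
        Finset.prod_congr rfl fun i hi => by rw [hsw i hi]
      rw [this]
      ring

lemma sum_rowMoment (h : m + 1 ≤ n) (π : Perm (Fin (m + 1))) :
    ∑ x, rowMoment h π x =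
      n * Wg h π + ∑ j : Fin m, Wg h (π * swap j.castSucc (Fin.last m)) := by
  obtain ⟨d, rfl⟩ : ∃ d, n = m + d := ⟨n - m, by omega⟩
  rw [Fin.sum_univ_add]
  have h1 : ∀ j : Fin m, rowMoment h π (Fin.castAdd d j) =
      Wg h π + Wg h (π * swap j.castSucc (Fin.last m)) := fun j => rowMoment_castSucc h π j
  have h2 : ∀ j : Fin d, rowMoment h π (Fin.natAdd m j) = Wg h π :=
    fun j => rowMoment_of_le h π _ (by simp)
  simp only [h1, h2, Finset.sum_add_distrib, Finset.sum_const, Finset.card_univ,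
    Fintype.card_fin, nsmul_eq_mul]
  push_cast
  ring

lemma sum_mul_star_eq (U : Matrix.unitaryGroup (Fin n) ℂ) (a b : Fin n) :
    ∑ x, U.1 x a * star (U.1 x b) = if a = b then 1 else 0 := by
  have := congrFun (congrFun (Matrix.mem_unitaryGroup_iff'.mp U.2) b) a
  simp only [Matrix.mul_apply, Matrix.star_apply, Matrix.one_apply] at this
  simpa only [mul_comm, eq_comm] using this

lemma sum_rowMoment_eq_integral (h : m + 1 ≤ n) (π : Perm (Fin (m + 1))) :
    ∑ x, rowMoment h π x = if Fin.last m = π (Fin.last m) then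
      ∫ U : Matrix.unitaryGroup (Fin n) ℂ,
        (∏ i : Fin m, U.1 (Fin.castLE h i.castSucc) (Fin.castLE h i.castSucc)) *
        star (∏ i : Fin m, U.1 (Fin.castLE h i.castSucc) (Fin.castLE h (π i.castSucc)))
          ∂haarUnitary n else 0 := by
  simp only [rowMoment]
  rw [← integral_finsetSum]
  · have : ∀ U : Matrix.unitaryGroup (Fin n) ℂ, ∑ x : Fin n,
        (∏ i : Fin m, U.1 (Fin.castLE h i.castSucc) (Fin.castLE h i.castSucc)) *
        U.1 x (Fin.castLE h (Fin.last m)) *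
        star ((∏ i : Fin m, U.1 (Fin.castLE h i.castSucc) (Fin.castLE h (π i.castSucc))) *
          U.1 x (Fin.castLE h (π (Fin.last m)))) =
        ((∏ i : Fin m, U.1 (Fin.castLE h i.castSucc) (Fin.castLE h i.castSucc)) *
        star (∏ i : Fin m, U.1 (Fin.castLE h i.castSucc) (Fin.castLE h (π i.castSucc)))) *
        if Fin.last m = π (Fin.last m) then 1 else 0 := by
      intro U
      have := sum_mul_star_eq U (Fin.castLE h (Fin.last m)) (Fin.castLE h (π (Fin.last m)))
      simp only [(Fin.castLE_injective h).eq_iff] at this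
      rw [← this, Finset.mul_sum]
      refine Finset.sum_congr rfl fun x _ => ?_
      rw [star_mul]
      ring
    simp only [this]
    split_ifs <;> simp
  · intro x _
    apply integrable_of_continuous
    refine Continuous.mul (Continuous.mul ?_ (continuous_entry _ _))
      (Continuous.star (Continuous.mul ?_ (continuous_entry _ _))) <;>
      exact continuous_finsetProd _ fun i _ => continuous_entry _ _

lemma wg_recursion_of_ne (h : m + 1 ≤ n) {π : Perm (Fin (m + 1))}
    (hπ : π (Fin.last m) ≠ Fin.last m) :
    n * Wg h π + ∑ j : Fin m, Wg h (π * swap j.castSucc (Fin.last m)) = 0 := by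
  rw [← sum_rowMoment, sum_rowMoment_eq_integral, if_neg hπ.symm]

lemma wg_recursion_extendLast (h : m + 1 ≤ n) (τ : Perm (Fin m)) :
    n * Wg h (extendLast τ) + ∑ j : Fin m, Wg h (extendLast τ * swap j.castSucc (Fin.last m)) =
      Wg (Nat.le_of_succ_le h) τ := by
  rw [← sum_rowMoment, sum_rowMoment_eq_integral, if_pos (extendLast_last τ).symm]
  simp only [extendLast_castSucc, Wg, Fin.castLE_castSucc]

lemma wg_zero (h : 0 ≤ n) (π : Perm (Fin 0)) : Wg h π = 1 := by
  simp [Wg]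

/-- Permuting the rows and reindexing the products exchanges the plain and the conjugated factors.
-/
lemma star_wg (h : m ≤ n) (π : Perm (Fin m)) : star (Wg h π) = Wg h π⁻¹ := by
  have hg : ∀ i, π.viaFintypeEmbedding (Fin.castLEEmb h) (Fin.castLE h i) =
      Fin.castLE h (π i) := fun i => Perm.viaFintypeEmbedding_apply_image π (Fin.castLEEmb h) i
  have key := integral_submatrix (π.viaFintypeEmbedding (Fin.castLEEmb h)) fun M =>
    (∏ i : Fin m, M (Fin.castLE h (π⁻¹ i)) (Fin.castLE h i)) *
      star (∏ i : Fin m, M (Fin.castLE h (π⁻¹ i)) (Fin.castLE h (π⁻¹ i)))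
  simp only [Matrix.submatrix_apply, id, hg, Perm.inv_def, apply_symm_apply] at key
  rw [Wg, Wg, Perm.inv_def, key, Complex.star_def, ← integral_conj]
  refine integral_congr_ae (Filter.Eventually.of_forall fun U => ?_)
  simp only [← Complex.star_def, star_mul, star_star]
  congr 1
  · rw [← Equiv.prod_comp π fun i => U.1 (Fin.castLE h (π.symm i)) (Fin.castLE h i)]
    exact Finset.prod_congr rfl fun i _ => by rw [symm_apply_apply]
  · exact congrArg star (Equiv.prod_comp π.symm fun i =>
      U.1 (Fin.castLE h i) (Fin.castLE h i)).symm

end Recursion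

/-! ### The Jucys–Murphy operator and extension by zero -/

section JucysMurphy

variable {m : ℕ}

/-- Right convolution with `c + J`, where `J` is the sum of the transpositions which move the
last point. -/
noncomputable def jucysMurphy (c : ℂ) (f : Perm (Fin (m + 1)) → ℂ) (π : Perm (Fin (m + 1))) : ℂ :=
  c * f π + ∑ j : Fin m, f (π * swap j.castSucc (Fin.last m))

/-- The extension by zero of a function along `extendLast`. -/
noncomputable def extendZero (f : Perm (Fin m) → ℂ) (π : Perm (Fin (m + 1))) : ℂ :=
  ∑ τ, if extendLast τ = π then f τ else 0

@[simp] lemma extendZero_extendLast (f : Perm (Fin m) → ℂ) (τ : Perm (Fin m)) :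
    extendZero f (extendLast τ) = f τ := by
  simp [extendZero, extendLast_injective.eq_iff]

lemma extendZero_of_ne (f : Perm (Fin m) → ℂ) {π : Perm (Fin (m + 1))}
    (h : π (Fin.last m) ≠ Fin.last m) : extendZero f π = 0 := by
  refine Finset.sum_eq_zero fun τ _ => if_neg ?_
  rintro rfl
  exact h (extendLast_last τ)

lemma sum_extendZero_mul (f : Perm (Fin m) → ℂ) (g : Perm (Fin (m + 1)) → ℂ) :
    ∑ σ, extendZero f σ * g σ = ∑ τ, f τ * g (extendLast τ) := by
  simp only [extendZero, Finset.sum_mul, ite_mul, zero_mul]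
  rw [Finset.sum_comm]
  simp

/-- The sum of the transpositions moving the last point commutes with `S_m`, so it acts alike from
both sides on functions supported there. -/
lemma sum_extendZero_mul_swap (f : Perm (Fin m) → ℂ) (π : Perm (Fin (m + 1))) :
    ∑ j : Fin m, extendZero f (π * swap j.castSucc (Fin.last m)) =
      ∑ j : Fin m, extendZero f (swap j.castSucc (Fin.last m) * π) := by
  by_cases h : π (Fin.last m) = Fin.last m
  · rw [Finset.sum_eq_zero, Finset.sum_eq_zero]
    · intro j _
      apply extendZero_of_ne
      rw [Perm.mul_apply, h, swap_apply_right]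
      exact (Fin.castSucc_lt_last j).ne
    · intro j _
      apply extendZero_of_ne
      rw [Perm.mul_apply, swap_apply_right]
      exact fun hj => (Fin.castSucc_lt_last j).ne (π.injective (hj.trans h.symm))
  · obtain ⟨p, hp⟩ := Fin.exists_castSucc_eq.mpr h
    have h' : π.symm (Fin.last m) ≠ Fin.last m := fun h' => h (by
      rw [← h', apply_symm_apply, h'])
    obtain ⟨q, hq⟩ := Fin.exists_castSucc_eq.mpr h'
    have hq' : π q.castSucc = Fin.last m := by rw [hq, apply_symm_apply]
    -- Only `q`, the preimage of the last point, contributes on the left and only its image `p` on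
    -- the right; the two arguments coincide.
    rw [Finset.sum_eq_single q, Finset.sum_eq_single p, mul_swap_eq_swap_mul, hq', hp, swap_comm]
    · intro j _ hj
      apply extendZero_of_ne
      rw [Perm.mul_apply, ← hp, swap_apply_of_ne_of_ne]
      · exact (Fin.castSucc_lt_last p).ne
      · exact fun h => hj (Fin.castSucc_injective _ h).symm
      · exact (Fin.castSucc_lt_last p).ne
    · simp
    · intro j _ hj
      apply extendZero_of_ne
      rw [Perm.mul_apply, swap_apply_right]
      exact fun h => hj (Fin.castSucc_injective _ (π.injective (h.trans hq'.symm)))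
    · simp

/-- Diagonal dominance: where `‖f π - g π‖` is maximal, the coefficient `n` is balanced by only `m <
n` terms of at most that size. -/
lemma jucysMurphy_injective {n : ℕ} (hn : m < n) :
    Function.Injective (jucysMurphy (m := m) (n : ℂ)) := by
  intro f g hfg
  obtain ⟨π, hπ⟩ := Finite.exists_max fun π : Perm (Fin (m + 1)) => ‖f π - g π‖
  have h1 : (n : ℂ) * (f π - g π) = -∑ j : Fin m, (f (π * swap j.castSucc (Fin.last m)) -
      g (π * swap j.castSucc (Fin.last m))) := by
    have := congrFun hfg π
    simp only [jucysMurphy] at this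
    rw [Finset.sum_sub_distrib]
    linear_combination this
  have h2 : (n : ℝ) * ‖f π - g π‖ ≤ m * ‖f π - g π‖ := by
    calc (n : ℝ) * ‖f π - g π‖ = ‖(n : ℂ) * (f π - g π)‖ := by simp
      _ ≤ ∑ j : Fin m, ‖f (π * swap j.castSucc (Fin.last m)) -
          g (π * swap j.castSucc (Fin.last m))‖ := by
        rw [h1, norm_neg]; exact norm_sum_le _ _
      _ ≤ ∑ j : Fin m, ‖f π - g π‖ := Finset.sum_le_sum fun j _ => hπ _
      _ = m * ‖f π - g π‖ := by simp
  have h3 : (m : ℝ) + 1 ≤ n := by exact_mod_cast hn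
  have h4 : ‖f π - g π‖ = 0 := by nlinarith [norm_nonneg (f π - g π)]
  ext σ
  have := hπ σ
  rw [h4] at this
  exact sub_eq_zero.mp (norm_le_zero_iff.mp this)

lemma jucysMurphy_wg {n : ℕ} (h : m + 1 ≤ n) :
    jucysMurphy (n : ℂ) (Wg h) = extendZero (Wg (Nat.le_of_succ_le h)) := by
  ext π
  by_cases hπ : π (Fin.last m) = Fin.last m
  · obtain ⟨τ, rfl⟩ := exists_extendLast_eq hπ
    rw [extendZero_extendLast]
    exact wg_recursion_extendLast h τ
  · rw [extendZero_of_ne _ hπ]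
    exact wg_recursion_of_ne h hπ

/-- The recursion has real coefficients, so by induction the conjugate satisfies it too, and its
solution is unique. -/
lemma star_wg_self {k n : ℕ} (h : k ≤ n) (π : Perm (Fin k)) : star (Wg h π) = Wg h π := by
  induction k with
  | zero => simp [wg_zero]
  | succ m ih =>
    revert π
    rw [← funext_iff]
    apply jucysMurphy_injective h
    rw [jucysMurphy_wg]
    ext π
    have h1 := congrArg star (congrFun (jucysMurphy_wg h) π)
    simp only [jucysMurphy, extendZero, star_add, star_mul', star_natCast, star_sum, apply_ite star,
      star_zero, ih] at h1 ⊢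
    exact h1

lemma wg_inv {k n : ℕ} (h : k ≤ n) (π : Perm (Fin k)) : Wg h π⁻¹ = Wg h π := by
  rw [← star_wg, star_wg_self]

end JucysMurphy

/-! ### Scalar identities for the ascension function -/

/-- The value of `A_{k,n}` at permutations with `f` fixed points. -/
noncomputable def ascensionValue (k n f : ℕ) : ℂ :=
  ∑ t ∈ Finset.range (f + 1), (-1 : ℂ) ^ (k - t) * (f.choose t : ℂ) *
    (1 / (n.ascFactorial (k - t) : ℂ))

lemma ascensionValue_succ_succ (k n f : ℕ) :
    ascensionValue (k + 1) n (f + 1) = ascensionValue (k + 1) n f + ascensionValue k n f := by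
  simp only [ascensionValue]
  rw [Finset.sum_range_succ' _ (f + 1), Finset.sum_range_succ' (fun t => (-1 : ℂ) ^ (k + 1 - t) *
    (f.choose t : ℂ) * (1 / (n.ascFactorial (k + 1 - t) : ℂ))) f]
  have h1 : ∀ t, (((f + 1).choose (t + 1) : ℕ) : ℂ) = f.choose t + f.choose (t + 1) := fun t => by
    rw [Nat.choose_succ_succ]; push_cast; ring
  simp only [h1, Nat.add_sub_add_right, mul_add, add_mul, Finset.sum_add_distrib,
    Nat.choose_zero_right]
  rw [Finset.sum_range_succ (fun t => (-1 : ℂ) ^ (k - t) * (f.choose (t + 1) : ℂ) *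
    (1 / (n.ascFactorial (k - t) : ℂ))), Nat.choose_succ_self]
  simp
  ring

/-- Pascal's rule reduces to `f = 0`, which is the recursion of the rising factorial. There the
truncated `f - 1` is harmless because its coefficient vanishes. -/
lemma ascensionValue_recursion {n : ℕ} (hn : 0 < n) {k f : ℕ} (hf : f ≤ k) :
    (n + k) * ascensionValue (k + 1) n f + ascensionValue k n f =
      f * ascensionValue k n (f - 1) := by
  induction f generalizing k with
  | zero =>
    have h1 : ((n + k : ℕ) : ℂ) ≠ 0 := Nat.cast_ne_zero.mpr (by omega)
    have h2 : (n.ascFactorial k : ℂ) ≠ 0 := by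
      obtain ⟨d, rfl⟩ : ∃ d, n = d + 1 := ⟨n - 1, by omega⟩
      exact Nat.cast_ne_zero.mpr (Nat.ascFactorial_pos d k).ne'
    push_cast at h1
    simp [ascensionValue, Nat.ascFactorial_succ, pow_succ]
    field_simp
    ring
  | succ f ih =>
    obtain ⟨l, rfl⟩ : ∃ l, k = l + 1 := ⟨k - 1, by omega⟩
    have h1 := ih (k := l + 1) (by omega)
    have h2 := ih (k := l) (by omega)
    rw [ascensionValue_succ_succ, ascensionValue_succ_succ, Nat.add_sub_cancel]
    rcases f with _ | f
    · push_cast at *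
      linear_combination h1 + h2
    · rw [Nat.add_sub_cancel] at h1 h2
      have h3 := ascensionValue_succ_succ l n f
      push_cast at *
      linear_combination h1 + h2 - (f + 1) * h3

/-- The bracket has the shape of a sum over `k` transpositions, of which `f` destroy a fixed point
and `k - f` change nothing. -/
lemma ascensionValue_recursion' {n : ℕ} (hn : 0 < n) {k f : ℕ} (hf : f ≤ k) :
    n * ascensionValue (k + 1) n f + (f * ascensionValue (k + 1) n (f - 1) +
      (k - f) * ascensionValue (k + 1) n f) = -ascensionValue k n f := by
  have h := ascensionValue_recursion hn hf
  rcases f with _ | f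
  · push_cast at *
    linear_combination h
  · rw [Nat.add_sub_cancel] at *
    have h3 := ascensionValue_succ_succ k n f
    push_cast at *
    linear_combination h - (f + 1) * h3

/-! ### The ascension function and the Jucys–Murphy operator -/

section Ascension

variable {m : ℕ}

lemma ascension_eq (k n : ℕ) (σ : Perm (Fin k)) :
    ascension k n σ = ascensionValue k n (fix σ) := rfl

lemma fix_mul_comm (σ τ : Perm (Fin m)) : fix (σ * τ) = fix (τ * σ) := by
  refine Finset.card_equiv τ fun i => ?_
  rw [Finset.mem_filter_univ, Finset.mem_filter_univ]
  simp

lemma ascension_mul_comm (n : ℕ) (σ τ : Perm (Fin m)) :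
    ascension m n (σ * τ) = ascension m n (τ * σ) := by
  rw [ascension_eq, ascension_eq, fix_mul_comm]

/-- The number of fixed points other than the last point. -/
def fixInit (π : Perm (Fin (m + 1))) : ℕ :=
  (Finset.univ.filter fun i : Fin m => π i.castSucc = i.castSucc).card

lemma fixInit_le (π : Perm (Fin (m + 1))) : fixInit π ≤ m :=
  (Finset.card_filter_le _ _).trans (by simp)

lemma fixInit_extendLast (τ : Perm (Fin m)) : fixInit (extendLast τ) = fix τ := by
  simp [fixInit, fix]

lemma fix_eq (π : Perm (Fin (m + 1))) :
    fix π = fixInit π + if π (Fin.last m) = Fin.last m then 1 else 0 := by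
  simp only [fix, fixInit, Finset.card_filter, Fin.sum_univ_castSucc]

lemma ascension_succ (n : ℕ) (π : Perm (Fin (m + 1))) :
    ascension (m + 1) n π =
      ascensionValue (m + 1) n (fixInit π) + extendZero (ascension m n) π := by
  rw [ascension_eq, fix_eq]
  by_cases h : π (Fin.last m) = Fin.last m
  · obtain ⟨τ, rfl⟩ := exists_extendLast_eq h
    rw [if_pos h, ascensionValue_succ_succ, extendZero_extendLast, ascension_eq,
      fixInit_extendLast]
  · rw [if_neg h, extendZero_of_ne _ h, add_zero, add_zero]

lemma swap_castSucc_last_of_ne {i j : Fin m} (h : i ≠ j) :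
    swap j.castSucc (Fin.last m) i.castSucc = i.castSucc :=
  swap_apply_of_ne_of_ne (fun h' => h (Fin.castSucc_injective _ h')) (Fin.castSucc_lt_last i).ne

lemma fixInit_mul_swap_of_ne {π : Perm (Fin (m + 1))} {j : Fin m}
    (h : π (Fin.last m) ≠ j.castSucc) :
    fixInit (π * swap j.castSucc (Fin.last m)) =
      if π j.castSucc = j.castSucc then fixInit π - 1 else fixInit π := by
  have h1 : (Finset.univ.filter fun i : Fin m =>
      (π * swap j.castSucc (Fin.last m)) i.castSucc = i.castSucc) =
      (Finset.univ.filter fun i : Fin m => π i.castSucc = i.castSucc).erase j := by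
    ext i
    rw [Finset.mem_erase, Finset.mem_filter_univ, Finset.mem_filter_univ]
    by_cases hij : i = j
    · subst hij; simp [h]
    · simp [hij, swap_castSucc_last_of_ne hij]
  rw [fixInit, h1, Finset.card_erase_eq_ite]
  simp [fixInit]

lemma fixInit_mul_swap_of_eq {π : Perm (Fin (m + 1))} {j : Fin m}
    (h : π (Fin.last m) = j.castSucc) :
    fixInit (π * swap j.castSucc (Fin.last m)) = fixInit π + 1 := by
  have hj : π j.castSucc ≠ j.castSucc := fun hj =>
    (Fin.castSucc_lt_last j).ne (π.injective (hj.trans h.symm))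
  have h1 : (Finset.univ.filter fun i : Fin m =>
      (π * swap j.castSucc (Fin.last m)) i.castSucc = i.castSucc) =
      insert j (Finset.univ.filter fun i : Fin m => π i.castSucc = i.castSucc) := by
    ext i
    rw [Finset.mem_insert, Finset.mem_filter_univ, Finset.mem_filter_univ]
    by_cases hij : i = j
    · subst hij; simp [h]
    · simp [hij, swap_castSucc_last_of_ne hij]
  rw [fixInit, h1, Finset.card_insert_of_notMem (by simpa using hj), fixInit]

lemma sum_ite_fixed (π : Perm (Fin (m + 1))) (a b : ℂ) :
    (∑ j : Fin m, if π j.castSucc = j.castSucc then a else b) =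
      fixInit π * a + (m - fixInit π) * b := by
  have h := Finset.card_filter_add_card_filter_not (s := (Finset.univ : Finset (Fin m)))
    (fun j => π j.castSucc = j.castSucc)
  rw [Finset.card_univ, Fintype.card_fin] at h
  have h' : ((Finset.univ.filter fun j : Fin m => ¬ π j.castSucc = j.castSucc).card : ℂ) =
      m - fixInit π := by
    rw [eq_sub_iff_add_eq, fixInit]; exact_mod_cast (add_comm _ _).trans h
  rw [Finset.sum_ite, Finset.sum_const, Finset.sum_const, nsmul_eq_mul, nsmul_eq_mul, h', fixInit]

/-- If `π` fixes the last point, each transposition destroys one counted fixed point or none, and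
`ascensionValue_recursion'` applies. Otherwise the transposition with `j = π (Fin.last m)` creates
one, and its surplus from Pascal's rule cancels the right-hand side of that recursion. -/
lemma jucysMurphy_fixInit {n : ℕ} (hn : 0 < n) :
    jucysMurphy (m := m) (n : ℂ) (fun π => -ascensionValue (m + 1) n (fixInit π)) =
      extendZero (ascension m n) := by
  ext π
  set g := ascensionValue (m + 1) n with hg
  have hrec := ascensionValue_recursion' hn (fixInit_le π)
  simp only [jucysMurphy, Finset.sum_neg_distrib]
  by_cases h : π (Fin.last m) = Fin.last m
  · have h1 : ∀ j : Fin m, g (fixInit (π * swap j.castSucc (Fin.last m))) =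
        if π j.castSucc = j.castSucc then g (fixInit π - 1) else g (fixInit π) := fun j => by
      rw [fixInit_mul_swap_of_ne (by rw [h]; exact (Fin.castSucc_lt_last j).ne'), apply_ite g]
    obtain ⟨τ, hτ⟩ := exists_extendLast_eq h
    rw [Finset.sum_congr rfl fun j _ => h1 j, sum_ite_fixed, ← hτ, extendZero_extendLast,
      ascension_eq, ← fixInit_extendLast, hτ]
    linear_combination -hrec
  · obtain ⟨p, hp⟩ := Fin.exists_castSucc_eq.mpr h
    have hpp : π p.castSucc ≠ p.castSucc := fun h' =>
      (Fin.castSucc_lt_last p).ne (π.injective (h'.trans hp))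
    have h1 : ∀ j : Fin m, g (fixInit (π * swap j.castSucc (Fin.last m))) =
        (if π j.castSucc = j.castSucc then g (fixInit π - 1) else g (fixInit π)) +
          if j = p then ascensionValue m n (fixInit π) else 0 := fun j => by
      by_cases hj : j = p
      · subst hj
        rw [fixInit_mul_swap_of_eq hp.symm, if_neg hpp, if_pos rfl, hg, ascensionValue_succ_succ]
      · have hpj : π (Fin.last m) ≠ j.castSucc := by
          rw [← hp]
          exact fun h' => hj (Fin.castSucc_injective _ h').symm
        rw [fixInit_mul_swap_of_ne hpj, apply_ite g, if_neg hj, add_zero]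
    rw [Finset.sum_congr rfl fun j _ => h1 j, Finset.sum_add_distrib, sum_ite_fixed,
      extendZero_of_ne _ h, Finset.sum_ite_eq' Finset.univ p, if_pos (Finset.mem_univ p)]
    linear_combination -hrec

lemma jucysMurphy_ascension (n : ℕ) :
    jucysMurphy (m := m) ((n + 1 : ℕ) : ℂ) (ascension (m + 1) (n + 1)) =
      jucysMurphy (n : ℂ) (extendZero (ascension m (n + 1))) := by
  ext π
  have h := congrFun (jucysMurphy_fixInit (m := m) n.succ_pos) π
  simp only [jucysMurphy, ascension_succ, Finset.sum_add_distrib, Finset.sum_neg_distrib,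
    Nat.cast_succ, Nat.succ_eq_add_one] at h ⊢
  linear_combination -h

/-- The Weingarten function of `U(n + 1)` in terms of the one of `U(n)`. -/
lemma wg_succ_right {k n : ℕ} (h : k ≤ n) (π : Perm (Fin k)) :
    Wg (h.trans n.le_succ) π = ∑ σ, ascension k (n + 1) (π * σ⁻¹) * Wg h σ := by
  induction k with
  | zero =>
    rw [Fintype.sum_subsingleton _ 1]
    simp [wg_zero, ascension, fix]
  | succ m ih =>
    revert π
    rw [← funext_iff]
    apply jucysMurphy_injective (h.trans n.le_succ)
    rw [jucysMurphy_wg]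
    ext π
    have hA : ∀ σ, ascension (m + 1) (n + 1) (π * σ⁻¹) =
        ascension (m + 1) (n + 1) (σ⁻¹ * π) := fun σ => ascension_mul_comm _ _ _
    have hAs : ∀ σ (j : Fin m),
        ascension (m + 1) (n + 1) (π * swap j.castSucc (Fin.last m) * σ⁻¹) =
          ascension (m + 1) (n + 1) (σ⁻¹ * π * swap j.castSucc (Fin.last m)) := fun σ j => by
      rw [ascension_mul_comm, mul_assoc]
    -- The ascension function is a class function, so the operator can be made to act on it alone.
    have h1 : jucysMurphy ((n + 1 : ℕ) : ℂ)
        (fun π => ∑ σ, ascension (m + 1) (n + 1) (π * σ⁻¹) * Wg h σ) π =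
        ∑ σ, Wg h σ * jucysMurphy ((n + 1 : ℕ) : ℂ) (ascension (m + 1) (n + 1)) (σ⁻¹ * π) := by
      simp only [jucysMurphy, hA, hAs, mul_add, Finset.sum_add_distrib, Finset.mul_sum]
      rw [Finset.sum_comm]
      congr 1
      · exact Finset.sum_congr rfl fun _ _ => by ring
      · exact Finset.sum_congr rfl fun _ _ => Finset.sum_congr rfl fun _ _ => by ring
    -- The operator, now n + J, moves onto `Wg`: on an extension by zero J may act from the left,
    -- and a translation of `σ` transfers it.
    have h2 : ∑ σ, Wg h σ * jucysMurphy ((n + 1 : ℕ) : ℂ) (ascension (m + 1) (n + 1)) (σ⁻¹ * π) =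
        ∑ σ, jucysMurphy (n : ℂ) (Wg h) σ * extendZero (ascension m (n + 1)) (σ⁻¹ * π) := by
      simp only [jucysMurphy_ascension]
      simp only [jucysMurphy, sum_extendZero_mul_swap, mul_add, add_mul, Finset.sum_add_distrib,
        Finset.mul_sum, Finset.sum_mul]
      congr 1
      · exact Finset.sum_congr rfl fun _ _ => by ring
      · rw [Finset.sum_comm, Finset.sum_comm (s := Finset.univ (α := Perm (Fin (m + 1))))]
        refine Finset.sum_congr rfl fun j _ => ?_
        rw [← Equiv.sum_comp (Equiv.mulRight (swap j.castSucc (Fin.last m)))]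
        refine Finset.sum_congr rfl fun σ _ => ?_
        simp [mul_assoc]
    rw [h1, h2, jucysMurphy_wg, sum_extendZero_mul]
    by_cases hπ : π (Fin.last m) = Fin.last m
    · obtain ⟨ρ, rfl⟩ := exists_extendLast_eq hπ
      rw [extendZero_extendLast, ih (Nat.le_of_succ_le h)]
      refine Finset.sum_congr rfl fun τ _ => ?_
      rw [← extendLast_inv, ← extendLast_mul, extendZero_extendLast, mul_comm,
        ascension_mul_comm]
    · rw [extendZero_of_ne _ hπ]
      refine (Finset.sum_eq_zero fun τ _ => ?_).symm
      rw [extendZero_of_ne, mul_zero]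
      intro h'
      rw [← extendLast_inv, Perm.mul_apply] at h'
      exact hπ ((extendLast τ⁻¹).injective (h'.trans (extendLast_last _).symm))

lemma aCoeff_eq (π : Perm (Fin (m + 1))) (τ : Perm (Fin m)) :
    aCoeff m π τ = -ascensionValue (m + 1) (m + 1) (fixInit (π * extendLast τ)) := by
  have h : fixInit (π * extendLast τ) = fixPair π τ := by simp [fixInit, fixPair]
  rw [h, aCoeff, ascensionValue, ← Finset.sum_neg_distrib]
  refine Finset.sum_congr rfl fun t _ => ?_
  rw [pow_succ]
  ring

/-- The Weingarten function of `U(m + 1)` on `S_{m+1}` in terms of the one of `U(m)` on `S_m`. -/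
lemma wg_succ_succ (m : ℕ) (π : Perm (Fin (m + 1))) :
    Wg le_rfl π = ∑ τ : Perm (Fin m), aCoeff m π τ * Wg le_rfl τ := by
  revert π
  rw [← funext_iff]
  apply jucysMurphy_injective (n := m + 1) m.lt_succ_self
  rw [jucysMurphy_wg]
  ext π
  have h1 : jucysMurphy ((m + 1 : ℕ) : ℂ)
      (fun π => ∑ τ : Perm (Fin m), aCoeff m π τ * Wg le_rfl τ) π =
      ∑ τ : Perm (Fin m), jucysMurphy ((m + 1 : ℕ) : ℂ)
        (fun π => -ascensionValue (m + 1) (m + 1) (fixInit π)) (π * extendLast τ) *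
        Wg le_rfl τ := by
    simp only [jucysMurphy, aCoeff_eq, add_mul, Finset.sum_add_distrib, Finset.mul_sum,
      Finset.sum_mul]
    refine congrArg₂ (· + ·) (Finset.sum_congr rfl fun _ _ => (mul_assoc _ _ _).symm) ?_
    · rw [Finset.sum_comm]
      refine Finset.sum_congr rfl fun τ _ => ?_
      -- Conjugation by `extendLast τ` permutes the transpositions, so J commutes with it after
      -- reindexing `j` by `τ`.
      have h2 : ∀ j : Fin m, π * swap (τ j).castSucc (Fin.last m) * extendLast τ =
          π * extendLast τ * swap j.castSucc (Fin.last m) := fun j => by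
        rw [mul_assoc, mul_assoc π, mul_swap_eq_swap_mul, extendLast_castSucc, extendLast_last]
      refine (Equiv.sum_comp τ fun j => -ascensionValue (m + 1) (m + 1)
        (fixInit (π * swap j.castSucc (Fin.last m) * extendLast τ)) * Wg le_rfl τ).symm.trans ?_
      exact Finset.sum_congr rfl fun j _ => by rw [h2]
  rw [h1, jucysMurphy_fixInit m.succ_pos]
  by_cases hπ : π (Fin.last m) = Fin.last m
  · obtain ⟨ρ, rfl⟩ := exists_extendLast_eq hπ
    -- The convolution has `τ⁻¹` where the sum has `τ`; inversion invariance of `Wg` reconciles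
    -- them.
    rw [extendZero_extendLast, wg_succ_right le_rfl, ← Equiv.sum_comp (Equiv.inv (Perm (Fin m)))]
    refine Finset.sum_congr rfl fun τ _ => ?_
    rw [← extendLast_mul, extendZero_extendLast]
    simp [wg_inv]
  · rw [extendZero_of_ne _ hπ]
    refine (Finset.sum_eq_zero fun τ _ => ?_).symm
    rw [extendZero_of_ne, zero_mul]
    rwa [Perm.mul_apply, extendLast_last]

end Ascension

/-! ### Sums over sequences of permutations -/

section Sequences

lemma sigmaSeq_of_mem {k n : ℕ} (π : Perm (Fin k)) (σ : Finset.Ico k n → Perm (Fin k)) {j : ℕ}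
    (hj : j ∈ Finset.Ico k n) : sigmaSeq π σ j = σ ⟨j, hj⟩ := dif_pos hj

lemma sigmaSeq_self {k n : ℕ} (π : Perm (Fin k)) (σ : Finset.Ico k n → Perm (Fin k)) :
    sigmaSeq π σ n = π := dif_neg (by simp)

/-- Splitting the last permutation off a sequence in `S_k`. -/
def sigmaEquiv {k n : ℕ} (h : k ≤ n) : (Finset.Ico k (n + 1) → Perm (Fin k)) ≃
    Perm (Fin k) × (Finset.Ico k n → Perm (Fin k)) where
  toFun f := (f ⟨n, by simp [h]⟩, fun j => f ⟨j, Finset.Ico_subset_Ico_right (Nat.le_succ _) j.2⟩)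
  invFun p j := sigmaSeq p.1 p.2 j
  left_inv f := by
    ext1 ⟨j, hj⟩
    by_cases hjn : j = n
    · subst hjn
      simp only [sigmaSeq_self]
    · have hj' : j ∈ Finset.Ico k n := by rw [Finset.mem_Ico] at hj ⊢; omega
      exact sigmaSeq_of_mem _ _ hj'
  right_inv p := by
    refine Prod.ext ?_ ?_
    · simp only [sigmaSeq_self]
    · ext1 j
      exact sigmaSeq_of_mem _ _ j.2

/-- Iteration of `wg_succ_right`; the remaining factor on `U(k)` is expanded by `sum_tauSeq`. -/
lemma sum_sigmaSeq {k n : ℕ} (h : k ≤ n) (π : Perm (Fin k)) :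
    ∑ σ : Finset.Ico k n → Perm (Fin k),
      (∏ j ∈ Finset.Ico k n, ascension k (j + 1) (sigmaSeq π σ (j + 1) * (sigmaSeq π σ j)⁻¹)) *
        Wg le_rfl (sigmaSeq π σ k) = Wg h π := by
  induction n, h using Nat.le_induction generalizing π with
  | base =>
    have : IsEmpty (Finset.Ico k k) :=
      Finset.isEmpty_coe_sort.mpr (Finset.Ico_self k)
    rw [Fintype.sum_unique]
    simp [sigmaSeq_self]
  | succ n h ih =>
    rw [← (sigmaEquiv h).symm.sum_comp, Fintype.sum_prod_type, wg_succ_right h]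
    refine Finset.sum_congr rfl fun s _ => ?_
    rw [← ih, Finset.mul_sum]
    refine Finset.sum_congr rfl fun g _ => ?_
    have h1 : ∀ j ∈ Finset.Ico k (n + 1),
        sigmaSeq π ((sigmaEquiv h).symm (s, g)) j = sigmaSeq s g j := fun j hj =>
      sigmaSeq_of_mem _ _ hj
    rw [Finset.prod_Ico_succ_top h, sigmaSeq_self, h1 n (by simp [h]), sigmaSeq_self,
      h1 k (by simp; omega)]
    have h2 : ∏ j ∈ Finset.Ico k n, ascension k (j + 1)
          (sigmaSeq π ((sigmaEquiv h).symm (s, g)) (j + 1) *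
            (sigmaSeq π ((sigmaEquiv h).symm (s, g)) j)⁻¹) =
        ∏ j ∈ Finset.Ico k n, ascension k (j + 1)
          (sigmaSeq s g (j + 1) * (sigmaSeq s g j)⁻¹) := by
      refine Finset.prod_congr rfl fun j hj => ?_
      rw [Finset.mem_Ico] at hj
      rw [h1 j (Finset.mem_Ico.mpr (by omega)), h1 (j + 1) (Finset.mem_Ico.mpr (by omega))]
    rw [h2]
    ring

lemma tauSeq_of_mem {k : ℕ} (ρ : Perm (Fin k)) (τ : (j : Finset.Ico 2 k) → Perm (Fin j)) {j : ℕ}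
    (hj : j ∈ Finset.Ico 2 k) : tauSeq ρ τ j = τ ⟨j, hj⟩ := dif_pos hj

lemma tauSeq_self {k : ℕ} (ρ : Perm (Fin k)) (τ : (j : Finset.Ico 2 k) → Perm (Fin j)) :
    tauSeq ρ τ k = ρ := by
  rw [tauSeq, dif_neg (by simp), dif_pos rfl]
  ext i
  simp

/-- Splitting the last permutation off a sequence with `j`-th entry in `S_j`. -/
def tauEquiv {k : ℕ} (h : 2 ≤ k) : ((j : Finset.Ico 2 (k + 1)) → Perm (Fin j)) ≃
    Perm (Fin k) × ((j : Finset.Ico 2 k) → Perm (Fin j)) where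
  toFun f := (f ⟨k, by simp [h]⟩, fun j => f ⟨j, Finset.Ico_subset_Ico_right (Nat.le_succ _) j.2⟩)
  invFun p j := tauSeq p.1 p.2 j
  left_inv f := by
    ext1 ⟨j, hj⟩
    by_cases hjk : j = k
    · subst hjk
      simp only [tauSeq_self]
    · have hj' : j ∈ Finset.Ico 2 k := by rw [Finset.mem_Ico] at hj ⊢; omega
      exact tauSeq_of_mem _ _ hj'
  right_inv p := by
    refine Prod.ext ?_ ?_
    · simp only [tauSeq_self]
    · ext1 j
      exact tauSeq_of_mem _ _ j.2

lemma wg_one_one (π : Perm (Fin 1)) : Wg le_rfl π = 1 := by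
  rw [wg_succ_succ, Fintype.sum_subsingleton _ 1]
  simp [wg_zero, aCoeff, fixPair]

lemma sum_tauSeq {k : ℕ} (h : 1 ≤ k) (ρ : Perm (Fin k)) :
    ∑ τ : (j : Finset.Ico 2 k) → Perm (Fin j),
      ∏ j ∈ Finset.Ico 1 k, aCoeff j (tauSeq ρ τ (j + 1)) (tauSeq ρ τ j) = Wg le_rfl ρ := by
  induction k, h using Nat.le_induction with
  | base =>
    have : IsEmpty (Finset.Ico 2 1) :=
      Finset.isEmpty_coe_sort.mpr rfl
    rw [Fintype.sum_unique, wg_one_one]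
    simp
  | succ k h ih =>
    rw [wg_succ_succ]
    -- The case `k = 1` is separate: `τ_1` is no summation variable, but the sum over `S_1` has a
    -- single term.
    rcases h.eq_or_lt with rfl | h2
    · have : IsEmpty (Finset.Ico 2 (1 + 1)) :=
      Finset.isEmpty_coe_sort.mpr rfl
      rw [Fintype.sum_unique, Fintype.sum_subsingleton _ 1, wg_one_one, Nat.Ico_succ_singleton,
        Finset.prod_singleton, tauSeq_self, Subsingleton.elim (tauSeq ρ _ 1) 1, mul_one]
    · rw [← (tauEquiv h2).symm.sum_comp, Fintype.sum_prod_type]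
      refine Finset.sum_congr rfl fun s _ => ?_
      rw [← ih, Finset.mul_sum]
      refine Finset.sum_congr rfl fun g _ => ?_
      have h1 : ∀ j ∈ Finset.Ico 1 (k + 1),
          tauSeq ρ ((tauEquiv h2).symm (s, g)) j = tauSeq s g j := fun j hj => by
        rw [Finset.mem_Ico] at hj
        -- At `j = 1` the group is trivial, so the default value of `tauSeq` is irrelevant.
        rcases hj.1.eq_or_lt with rfl | hj'
        · exact Subsingleton.elim (α := Perm (Fin 1)) _ _
        · exact tauSeq_of_mem _ _ (Finset.mem_Ico.mpr (by omega))
      rw [Finset.prod_Ico_succ_top h, tauSeq_self, h1 k (by simp [h]), tauSeq_self, mul_comm]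
      congr 1
      refine Finset.prod_congr rfl fun j hj => ?_
      rw [Finset.mem_Ico] at hj
      rw [h1 j (Finset.mem_Ico.mpr (by omega)), h1 (j + 1) (Finset.mem_Ico.mpr (by omega))]

end Sequences

end Weingarten

theorem proposition3p9 (k n : ℕ) (hk : 0 < k) (hkn : k ≤ n) (π : Equiv.Perm (Fin k)) :
    Weingarten.Wg hkn π =
      ∑ σ : Finset.Ico k n → Equiv.Perm (Fin k),
        ∑ τ : (j : Finset.Ico 2 k) → Equiv.Perm (Fin j),
          (∏ j ∈ Finset.Ico k n,
            Weingarten.ascension k (j + 1)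
              (Weingarten.sigmaSeq π σ (j + 1) * (Weingarten.sigmaSeq π σ j)⁻¹)) *
          (∏ j ∈ Finset.Ico 1 k,
            Weingarten.aCoeff j
              (Weingarten.tauSeq (Weingarten.sigmaSeq π σ k) τ (j + 1))
              (Weingarten.tauSeq (Weingarten.sigmaSeq π σ k) τ j)) := by
  simp only [← Finset.mul_sum, Weingarten.sum_tauSeq hk]
  exact (Weingarten.sum_sigmaSeq hkn π).symm
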